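/- Let $m,n\ge 0$ and let $\mathfrak g=\mathfrak{gl}(m|n)$ be the complex general linear Lie superalgebra, with Cartan subalgebra $\mathfrak h$ of diagonal matrices. Let $\delta_1,\dots,\delta_m,\epsilon_1,\dots,\epsilon_n$ be the basis of $\mathfrak h^*$ dual to the diagonal matrix units, so that the roots are the differences of two distinct elements of this basis. Let $\lambda=(\lambda_1\ge\lambda_2\ge\cdots)$ be an $(m|n)$-hook partition, i.e. $\lambda_{m+1}\le n$, with conjugate partition $\lambda'$. Put $$\lambda^\natural=\sum_{i=1}^m\lambda_i\delta_i+\sum_{j=1}^n\nu_j\epsilon_j,$$ where $\nu=(\lambda_{m+1},\lambda_{m+2},\dots)'$, and let $L(\lambda^\natural)$ be the simple $\mathfrak g$-module of highest weight $\lambda^\natural$ with respect to the standard (upper triangular) Borel subalgebra. Let $\mathfrak b\supseteq\mathfrak h$ be an arbitrary Borel subalgebra of $\mathfrak g$, i.e. $\mathfrak b=\mathfrak h\oplus\bigoplus_{\alpha\in\Phi^+}\mathfrak g_\alpha$ for a positive system $\Phi^+$. There is a unique ordering $\eta_1,\dots,\eta_{m+n}$ of $\delta_1,\dots,\delta_m,\epsilon_1,\dots,\epsilon_n$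 such that the simple roots of $\mathfrak b$ are $\eta_1-\eta_2,\dots,\eta_{m+n-1}-\eta_{m+n}$; dropping the indices gives the $\epsilon\delta$-sequence of $\mathfrak b$. Define $\lambda^{\mathfrak b}\in\mathfrak h^*$ by going through $\eta_1,\eta_2,\dots,\eta_{m+n}$ in this order, starting with the Young diagram of $\lambda$: if $\eta_k$ is a $\delta$, its coefficient is the length of the first row of the current diagram, and this row is removed; if $\eta_k$ is an $\epsilon$, its coefficient is the length of the first column of the current diagram, and this column is removed. **Theorem.** The $\mathfrak b$-highest weight of $L(\lambda^\natural)$ is $\lambda^{\mathfrak b}$: a weight $\mu\in\mathfrak h^*$ is the weight of a $\mathfrak b$-highest weight vector of $L(\lambda^\natural)$ if and only if $\mu=\lambda^{\mathfrak b}$. Suppose moreover that all simple roots of $\mathfrak b$ are odd, and for a partition $\mu$ let $p_i(\mu)=\max\{\mu_i-i+1,0\}$ and $q_i(\mu)=\max\{\mu'_i-i,0\}$, $i\ge1$, be its modified Frobenius coordinates. If the $\epsilon\delta$-sequence of $\mathfrak b$ starts with $\delta$, then in $\lambda^{\mathfrak b}$ the coefficient of the $i$-th $\delta$ of the ordering is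 $p_i(\lambda)$ and that of the $i$-th $\epsilon$ is $q_i(\lambda)$. If it starts with $\epsilon$, then the coefficient of the $i$-th $\epsilon$ is $p_i(\lambda')$ and that of the $i$-th $\delta$ is $q_i(\lambda')$. -/

import Mathlib

/-! ### The Lie superalgebra `gl(m|n)` -/

namespace GLSuper

/-- The index set `I(m|n)`: `Sum.inl i` is the barred index of `δ_i`, `Sum.inr j` the index of
`ε_j`. -/
abbrev Idx (m n : ℕ) : Type := Fin m ⊕ Fin n

/-- The underlying space of `gl(m|n)`: square matrices indexed by `I(m|n)`. -/
abbrev Gl (m n : ℕ) : Type := Matrix (Idx m n) (Idx m n) ℂ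

/-- Weights: the dual of the space of diagonal matrices, in the coordinates given by the basis
`δ_i, ε_j` dual to the diagonal matrix units. -/
abbrev Weight (m n : ℕ) : Type := Idx m n → ℂ

variable {m n : ℕ}

/-- The parity of a basis vector of `ℂ^{m|n}`. -/
def parity : Idx m n → ZMod 2
  | Sum.inl _ => 0
  | Sum.inr _ => 1

/-- The Koszul sign `(-1)^{s t}`. -/
def sign (s t : ZMod 2) : ℂ := (-1) ^ (s.val * t.val)

/-- The component of parity `s` of a matrix. -/
def part (s : ZMod 2) (x : Gl m n) : Gl m n :=
  Matrix.of fun i j => if parity i + parity j = s then x i j else 0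

/-- `x` is homogeneous of parity `s`. -/
def IsHomog (s : ZMod 2) (x : Gl m n) : Prop :=
  ∀ i j, parity i + parity j ≠ s → x i j = 0

/-- The bracket of `gl(m|n)`: the bilinear extension of `[x, y] = x y - (-1)^{|x||y|} y x` from
homogeneous matrices. -/
def superBracket (x y : Gl m n) : Gl m n :=
  ∑ s : ZMod 2, ∑ t : ZMod 2,
    (part s x * part t y - sign s t • (part t y * part s x))

/-- The matrix unit `E_{ij}`. -/
def E (i j : Idx m n) : Gl m n := Matrix.single i j 1

/-- The Cartan subalgebra of diagonal matrices. -/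
def cartan (m n : ℕ) : Submodule ℂ (Gl m n) where
  carrier := {x | ∀ i j, i ≠ j → x i j = 0}
  zero_mem' := fun _ _ _ => rfl
  add_mem' := fun {x y} hx hy i j h => by simp [hx i j h, hy i j h]
  smul_mem' := fun c x hx i j h => by simp [hx i j h]

/-- The weight `ε_i - ε_j` (with `ε_{\bar i} = δ_i`); for `i ≠ j` it is a root, whose root space
is spanned by `E i j`. -/
def root (i j : Idx m n) : Weight m n := Pi.single i 1 - Pi.single j 1

/-! ### Borel subalgebras -/

/-- A Borel subalgebra of `gl(m|n)` (containing the Cartan subalgebra of diagonal matrices): a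
subalgebra that contains the diagonal matrices and, of every pair of opposite root spaces, exactly
one. Equivalently, the sum of the Cartan subalgebra and of the root spaces of a positive system. -/
structure Borel (m n : ℕ) where
  carrier : Submodule ℂ (Gl m n)
  cartan_le : cartan m n ≤ carrier
  bracket_mem : ∀ x ∈ carrier, ∀ y ∈ carrier, superBracket x y ∈ carrier
  root_xor : ∀ i j, i ≠ j → Xor (E i j ∈ carrier) (E j i ∈ carrier)

lemma part_single (s : ZMod 2) (i j : Idx m n) :
    part s (E i j) = if parity i + parity j = s then E i j else 0 := by
  ext a b
  by_cases ha : i = a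
  · by_cases hb : j = b
    · subst ha hb
      by_cases h : parity i + parity j = s <;> simp [part, E, h]
    · by_cases h : parity i + parity j = s <;> simp [part, E, h, Matrix.single, hb]
  · by_cases h : parity i + parity j = s <;> simp [part, E, h, Matrix.single, ha]

lemma superBracket_E {i j k : Idx m n} (h : i ≠ k) :
    superBracket (E i j) (E j k) = E i k := by
  simp only [superBracket, part_single]
  rw [Finset.sum_eq_single (parity i + parity j), Finset.sum_eq_single (parity j + parity k)]
  · have h1 : E j k * E i j = (0 : Gl m n) := by
      simp [E, Matrix.single_mul_single_of_ne, h.symm]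
    have h2 : E i j * E j k = (E i k : Gl m n) := by simp [E]
    simp [h1, h2]
  · intro t _ ht
    simp [ht.symm]
  · simp
  · intro s _ hs
    simp [hs.symm]
  · simp

lemma part_blockTriangular {x : Gl m n} {s : ZMod 2}
    (hx : x.BlockTriangular (toLex : Idx m n → Fin m ⊕ₗ Fin n)) :
    (part s x).BlockTriangular (toLex : Idx m n → Fin m ⊕ₗ Fin n) := by
  intro i j hij
  simp [part, hx hij]

namespace Borel

/-- The standard Borel subalgebra: upper triangular matrices with respect to the order
`\bar 1 < ⋯ < \bar m < 1 < ⋯ < n`. -/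
def standard (m n : ℕ) : Borel m n where
  carrier :=
    { carrier := {x | x.BlockTriangular (toLex : Idx m n → Fin m ⊕ₗ Fin n)}
      zero_mem' := Matrix.blockTriangular_zero
      add_mem' := fun hx hy => hx.add hy
      smul_mem' := fun c x hx i j h => by simp [hx h] }
  cartan_le := fun x hx i j h => hx i j (by rintro rfl; exact lt_irrefl _ h)
  bracket_mem := fun x hx y hy => by
    refine Submodule.sum_mem _ fun s _ => Submodule.sum_mem _ fun t _ => Submodule.sub_mem _ ?_
      (Submodule.smul_mem _ _ ?_)
    · exact Matrix.BlockTriangular.mul (part_blockTriangular hx) (part_blockTriangular hy)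
    · exact Matrix.BlockTriangular.mul (part_blockTriangular hy) (part_blockTriangular hx)
  root_xor := fun i j hij => by
    have key : ∀ a b : Idx m n,
        (E a b).BlockTriangular (toLex : Idx m n → Fin m ⊕ₗ Fin n) ↔ toLex a ≤ toLex b := by
      intro a b
      constructor
      · intro h
        by_contra hlt
        have := h (not_le.mp hlt)
        simp [E] at this
      · intro h i j hlt
        have : ¬ (a = i ∧ b = j) := by
          rintro ⟨rfl, rfl⟩
          exact absurd hlt (not_lt.mpr h)
        simp only [E, Matrix.single, Matrix.of_apply, if_neg this]
    change Xor ((E i j).BlockTriangular _) ((E j i).BlockTriangular _)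
    rw [key, key]
    have hne : (toLex i : Fin m ⊕ₗ Fin n) ≠ toLex j := fun h => hij (toLex.injective h)
    rcases lt_or_gt_of_ne hne with h | h
    · exact Or.inl ⟨h.le, not_le.mpr h⟩
    · exact Or.inr ⟨h.le, not_le.mpr h⟩

variable (B : Borel m n)

/-- The nilradical `n⁺` of `b = h ⊕ n⁺`: the sum of the root spaces contained in `b`. -/
def nilradical : Submodule ℂ (Gl m n) :=
  Submodule.span ℂ {x | ∃ i j, i ≠ j ∧ E i j ∈ B.carrier ∧ x = E i j}

/-- The positive roots: the roots whose root space lies in `b`. -/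
def posRoots : Set (Weight m n) :=
  {α | ∃ i j, i ≠ j ∧ E i j ∈ B.carrier ∧ α = root i j}

/-- The simple roots: the positive roots that are not the sum of two positive roots. -/
def simpleRoots : Set (Weight m n) :=
  {α | α ∈ B.posRoots ∧ ¬ ∃ β ∈ B.posRoots, ∃ γ ∈ B.posRoots, α = β + γ}

/-- The order on `I(m|n)` defined by `b`: `i` precedes `j` if `i = j` or `ε_i - ε_j` is a positive
root. -/
def le (i j : Idx m n) : Prop := E i j ∈ B.carrier

lemma le_refl (i : Idx m n) : B.le i i := by
  refine B.cartan_le fun a b hab => ?_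
  have : ¬ (i = a ∧ i = b) := by
    rintro ⟨rfl, rfl⟩
    exact hab rfl
  simp only [E, Matrix.single, Matrix.of_apply, if_neg this]

instance : IsTrans (Idx m n) B.le where
  trans i j k hij hjk := by
    by_cases h : i = k
    · subst h
      exact B.le_refl i
    · have := B.bracket_mem _ hij _ hjk
      rwa [superBracket_E h] at this

instance : Std.Antisymm B.le where
  antisymm i j hij hji := by
    by_contra h
    rcases B.root_xor i j h with ⟨_, h'⟩ | ⟨_, h'⟩
    · exact h' hji
    · exact h' hij

instance : Std.Total B.le where
  total i j := by
    by_cases h : i = j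
    · subst h
      exact Or.inl (B.le_refl i)
    · rcases B.root_xor i j h with ⟨h', _⟩ | ⟨h', _⟩
      · exact Or.inl h'
      · exact Or.inr h'

open Classical in
/-- The list `i_1, …, i_{m+n}` of all indices for which the simple roots of `b` are
`ε_{i_1} - ε_{i_2}, …, ε_{i_{m+n-1}} - ε_{i_{m+n}}` (see `mem_simpleRoots_iff`). Its pattern of
`Sum.inl`s and `Sum.inr`s is the `εδ`-sequence of `b`. -/
noncomputable def indexSeq : List (Idx m n) := Finset.sort Finset.univ B.le

lemma mem_indexSeq (i : Idx m n) : i ∈ B.indexSeq := by simp [indexSeq]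

lemma nodup_indexSeq : B.indexSeq.Nodup := by
  classical exact Finset.sort_nodup _ _

lemma pairwise_indexSeq : B.indexSeq.Pairwise B.le := by
  classical exact Finset.pairwise_sort _ _

lemma le_getElem {a b : ℕ} (hab : a < b) (hb : b < B.indexSeq.length) :
    B.le B.indexSeq[a] B.indexSeq[b] :=
  List.pairwise_iff_getElem.mp B.pairwise_indexSeq a b (hab.trans hb) hb hab

lemma lt_of_le_getElem {a b : ℕ} (ha : a < B.indexSeq.length) (hb : b < B.indexSeq.length)
    (hne : B.indexSeq[a] ≠ B.indexSeq[b]) (h : B.le B.indexSeq[a] B.indexSeq[b]) : a < b := by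
  rcases lt_trichotomy a b with h' | h' | h'
  · exact h'
  · subst h'
    exact absurd rfl hne
  · exact absurd (Std.Antisymm.antisymm (r := B.le) _ _ h (B.le_getElem h' ha)) hne

/-- The simple roots of `b` are the differences of consecutive entries of `indexSeq`. -/
theorem mem_simpleRoots_iff (α : Weight m n) :
    α ∈ B.simpleRoots ↔ ∃ (k : ℕ) (h : k + 1 < B.indexSeq.length),
      α = root B.indexSeq[k] B.indexSeq[k + 1] := by
  have hinj : ∀ {a b : ℕ} (ha : a < B.indexSeq.length) (hb : b < B.indexSeq.length),
      a ≠ b → B.indexSeq[a] ≠ B.indexSeq[b] := fun ha hb hab h =>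
    hab ((B.nodup_indexSeq.getElem_inj_iff).mp h)
  constructor
  · rintro ⟨⟨i, j, hij, hle, rfl⟩, hno⟩
    obtain ⟨a, ha, rfl⟩ := List.getElem_of_mem (B.mem_indexSeq i)
    obtain ⟨b, hb, rfl⟩ := List.getElem_of_mem (B.mem_indexSeq j)
    have hab := B.lt_of_le_getElem ha hb hij hle
    by_cases hb' : b = a + 1
    · subst hb'
      exact ⟨a, hb, rfl⟩
    · have h1 : a + 1 < b := by omega
      have h2 : a + 1 < B.indexSeq.length := h1.trans hb
      refine absurd ⟨_, ⟨_, _, hinj ha h2 (by omega), B.le_getElem (by omega) h2, rfl⟩, _,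
        ⟨_, _, hinj h2 hb (by omega), B.le_getElem h1 hb, rfl⟩, ?_⟩ hno
      simp [root]
  · rintro ⟨k, hk, rfl⟩
    refine ⟨⟨_, _, hinj (by omega) hk (by omega), B.le_getElem (by omega) hk, rfl⟩, ?_⟩
    choose p hp hpe using fun i => List.getElem_of_mem (B.mem_indexSeq i)
    have hpk : ∀ (a : ℕ) (ha : a < B.indexSeq.length), p B.indexSeq[a] = a := fun a ha =>
      (B.nodup_indexSeq.getElem_inj_iff).mp (hpe B.indexSeq[a])
    let φ : Weight m n → ℂ := fun w => w ⬝ᵥ fun x => (p x : ℂ)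
    have hφ : ∀ i j, φ (root i j) = (p i : ℂ) - p j := by
      intro i j
      simp only [φ, root, sub_dotProduct, single_dotProduct, one_mul]
    have hlt : ∀ i j, i ≠ j → E i j ∈ B.carrier → p i < p j := by
      intro i j hij h
      apply B.lt_of_le_getElem (hp i) (hp j)
      · rwa [hpe, hpe]
      · rwa [hpe, hpe]
    rintro ⟨β, ⟨a, b, hab, hle, rfl⟩, γ, ⟨c, d, hcd, hle', rfl⟩, h⟩
    have h1 := hlt a b hab hle
    have h2 := hlt c d hcd hle'
    have h3 : φ (root B.indexSeq[k] B.indexSeq[k + 1]) = φ (root a b) + φ (root c d) := by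
      rw [h]
      exact add_dotProduct _ _ _
    rw [hφ, hφ, hφ, hpk, hpk] at h3
    have h4 : (k : ℤ) - (k + 1 : ℕ) = ((p a : ℤ) - p b) + ((p c : ℤ) - p d) := by
      exact_mod_cast h3
    omega

/-- The indices of the `δ`s, in the order in which they occur in the sequence of `b`. -/
noncomputable def deltaSeq : List (Fin m) := B.indexSeq.filterMap Sum.getLeft?

/-- The indices of the `ε`s, in the order in which they occur in the sequence of `b`. -/
noncomputable def epsSeq : List (Fin n) := B.indexSeq.filterMap Sum.getRight?

/-- All simple roots of `b` are odd. -/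
def AllOdd : Prop := ∀ i j, root i j ∈ B.simpleRoots → parity i ≠ parity j

end Borel

/-! ### Modules -/

/-- A module over the Lie superalgebra `gl(m|n)` on the complex vector space `L`: a
`ℤ/2`-grading of `L` and a parity preserving linear action compatible with the superbracket. -/
structure SuperModule (m n : ℕ) (L : Type*) [AddCommGroup L] [Module ℂ L] where
  grade : ZMod 2 → Submodule ℂ L
  isInternal : DirectSum.IsInternal grade
  act : Gl m n →ₗ[ℂ] Module.End ℂ L
  act_mem : ∀ s t x v, IsHomog s x → v ∈ grade t → act x v ∈ grade (s + t)
  act_bracket : ∀ s t x y, IsHomog s x → IsHomog t y →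
    act (superBracket x y) = act x * act y - sign s t • (act y * act x)

namespace SuperModule

variable {L : Type*} [AddCommGroup L] [Module ℂ L] (M : SuperModule m n L)

/-- A submodule: a graded subspace that is stable under the action. -/
def IsSubmodule (N : Submodule ℂ L) : Prop :=
  N ≤ ⨆ s, N ⊓ M.grade s ∧ ∀ x, ∀ v ∈ N, M.act x v ∈ N

/-- A simple module: nonzero and without proper nonzero submodules. -/
def IsSimple : Prop :=
  Nontrivial L ∧ ∀ N : Submodule ℂ L, M.IsSubmodule N → N = ⊥ ∨ N = ⊤

/-- `v` is a `b`-highest weight vector of weight `μ`. -/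
def IsHighestWeightVector (B : Borel m n) (μ : Weight m n) (v : L) : Prop :=
  v ≠ 0 ∧ (∀ x ∈ B.nilradical, M.act x v = 0) ∧
    ∀ h ∈ cartan m n, M.act h v = (∑ i, μ i * h i i) • v

/-- `μ` is a `b`-highest weight of the module, which is meant to be simple (so that it is
generated by any nonzero vector). -/
def HasHighestWeight (B : Borel m n) (μ : Weight m n) : Prop :=
  ∃ v, M.IsHighestWeightVector B μ v

end SuperModule

/-! ### Partitions and the weights read off from them -/

/-- `μ` with its first row removed. -/
noncomputable def removeRow (μ : YoungDiagram) : YoungDiagram where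
  cells := μ.cells.preimage (Prod.map (· + 1) id)
    ((add_left_injective 1).prodMap Function.injective_id).injOn
  isLowerSet := fun a b hba ha => by
    rw [Finset.coe_preimage] at ha ⊢
    exact μ.isLowerSet (Prod.mk_le_mk.mpr ⟨Nat.succ_le_succ hba.1, hba.2⟩) ha

/-- `μ` with its first column removed. -/
noncomputable def removeCol (μ : YoungDiagram) : YoungDiagram where
  cells := μ.cells.preimage (Prod.map id (· + 1))
    (Function.injective_id.prodMap (add_left_injective 1)).injOn
  isLowerSet := fun a b hba ha => by
    rw [Finset.coe_preimage] at ha ⊢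
    exact μ.isLowerSet (Prod.mk_le_mk.mpr ⟨hba.1, Nat.succ_le_succ hba.2⟩) ha

lemma mem_removeRow {μ : YoungDiagram} {i j : ℕ} : (i, j) ∈ removeRow μ ↔ (i + 1, j) ∈ μ := by
  rw [← YoungDiagram.mem_cells, ← YoungDiagram.mem_cells]
  simp [removeRow]

lemma mem_removeCol {μ : YoungDiagram} {i j : ℕ} : (i, j) ∈ removeCol μ ↔ (i, j + 1) ∈ μ := by
  rw [← YoungDiagram.mem_cells, ← YoungDiagram.mem_cells]
  simp [removeCol]

/-- `(m|n)`-hook partitions: `μ_{m+1} ≤ n`. (`rowLen i` is the length of row number `i + 1`.) -/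
def IsHook (m n : ℕ) (μ : YoungDiagram) : Prop := μ.rowLen m ≤ n

/-- The weight `μ^♮`: the first `m` row lengths of `μ` are the coefficients of the `δ`s, and the
column lengths of `μ` with the first `m` rows removed are those of the `ε`s. -/
noncomputable def natural (m n : ℕ) (μ : YoungDiagram) : Weight m n
  | Sum.inl i => μ.rowLen i
  | Sum.inr j => (removeRow^[m] μ).colLen j

/-- Read a weight off `μ` along a list of indices: for a `δ`, the length of the first row of the
current diagram, which is then removed; for an `ε`, the same with the first column. -/
noncomputable def readWeight : List (Idx m n) → YoungDiagram → Weight m n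
  | [], _ => 0
  | Sum.inl i :: l, μ =>
      Function.update (readWeight l (removeRow μ)) (Sum.inl i) (μ.rowLen 0 : ℂ)
  | Sum.inr j :: l, μ =>
      Function.update (readWeight l (removeCol μ)) (Sum.inr j) (μ.colLen 0 : ℂ)

/-- The weight `μ^b`. -/
noncomputable def borelWeight (B : Borel m n) (μ : YoungDiagram) : Weight m n :=
  readWeight B.indexSeq μ

/-- The modified Frobenius coordinate `p_i = max (μ_i - i + 1, 0)`, for `i = k + 1`. -/
def frobP (μ : YoungDiagram) (k : ℕ) : ℤ := max ((μ.rowLen k : ℤ) - (k + 1) + 1) 0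

/-- The modified Frobenius coordinate `q_i = max (μ'_i - i, 0)`, for `i = k + 1`. -/
def frobQ (μ : YoungDiagram) (k : ℕ) : ℤ := max ((μ.colLen k : ℤ) - (k + 1)) 0

end GLSuper

/-! Any two orderings of the indices are linked by interchanges of adjacent entries. So it suffices
to follow a highest weight vector through one interchange, starting from the standard ordering,
along which `readWeight` gives `natural` (`readWeight_standardSeq`).

Let `a` immediately precede `b`, put e = `E a b`, f = `E b a`, and let v be a highest weight vector
of weight μ. If the root is even and μ a - μ b = k is a natural number, the highest weight vector
for the new ordering is f^k v. If the root is odd, it is v when μ a + μ b = 0 and f v otherwise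
(`IsSimple.exists_reflected`). Diagrams obey the same rule (`reflectsTo_update_update`). Two rows,
or two columns, are exchanged between `a` and `b`. A row and a column share the corner box, which
counts for whichever is read first, and the odd sum vanishes exactly when the current diagram is
empty.

The vanishing statements need no finite dimensionality; they follow from uniqueness of the highest
weight in a simple module (`IsSimple.weight_unique`). Vectors such as f^(k+1) v are killed by all
positive root vectors but have a weight other than μ, so they are zero. Uniqueness holds because the
lowered vectors span a graded submodule, hence everything, and all except v itself lie in other
eigenspaces of a Cartan element measuring height.

For the Frobenius coordinates, deleting the first entry of an alternating sequence exchanges the two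
cases and transposes the roles of p and q (`readWeight_alternating`). -/

namespace GLSuper

variable {m n : ℕ}

/-! ### Brackets of matrix units -/

lemma sign_zero_left (t : ZMod 2) : sign 0 t = 1 := by simp [sign]

lemma parity_add_self (i : Idx m n) : parity i + parity i = 0 := CharTwo.add_self_eq_zero _

lemma isHomog_E (i j : Idx m n) : IsHomog (parity i + parity j) (E i j) := by
  intro a b h
  have : ¬ (i = a ∧ j = b) := by
    rintro ⟨rfl, rfl⟩
    exact h rfl
  simp only [E, Matrix.single, Matrix.of_apply, if_neg this]

lemma E_mul_E (i j k l : Idx m n) : E i j * E k l = if j = k then E i l else (0 : Gl m n) := by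
  split_ifs with h
  · subst h
    simp [E]
  · simp [E, Matrix.single_mul_single_of_ne, h]

lemma superBracket_E_E (i j k l : Idx m n) :
    superBracket (E i j) (E k l) = (if j = k then E i l else 0) -
      sign (parity i + parity j) (parity k + parity l) • (if l = i then E k j else 0) := by
  simp only [superBracket, part_single]
  rw [Finset.sum_eq_single (parity i + parity j), Finset.sum_eq_single (parity k + parity l)]
  · simp only [if_true, E_mul_E]
  · intro t _ ht
    simp [ht.symm]
  · simp
  · intro s _ hs
    simp [hs.symm]
  · simp

lemma eq_sum_E (x : Gl m n) : x = ∑ i, ∑ j, x i j • E i j := by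
  conv_lhs => rw [Matrix.matrix_eq_sum_single x]
  simp [E, Matrix.smul_single]

/-! ### Weight vectors -/

namespace SuperModule

variable {L : Type*} [AddCommGroup L] [Module ℂ L] (M : SuperModule m n L)

lemma act_E_act_E (i j k l : Idx m n) (v : L) :
    M.act (E i j) (M.act (E k l) v) = M.act (superBracket (E i j) (E k l)) v +
      sign (parity i + parity j) (parity k + parity l) • M.act (E k l) (M.act (E i j) v) := by
  rw [M.act_bracket _ _ _ _ (isHomog_E i j) (isHomog_E k l)]
  simp

/-- `v` lies in the weight space of weight `μ`. -/
def IsWeightVector (μ : Weight m n) (v : L) : Prop := ∀ i, M.act (E i i) v = μ i • v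

variable {M}

lemma IsWeightVector.smul {μ : Weight m n} {v : L} (h : M.IsWeightVector μ v) (c : ℂ) :
    M.IsWeightVector μ (c • v) := fun i => by rw [map_smul, h i, smul_comm]

lemma IsWeightVector.act {μ : Weight m n} {v : L} (h : M.IsWeightVector μ v) (i j : Idx m n) :
    M.IsWeightVector (μ + root i j) (M.act (E i j) v) := by
  intro c
  rw [act_E_act_E, superBracket_E_E, parity_add_self, sign_zero_left, one_smul, one_smul, h c,
    map_smul, Pi.add_apply, add_smul, add_comm]
  congr 1
  rcases eq_or_ne c i with rfl | hi <;> rcases eq_or_ne j c with rfl | hj <;>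
    simp [root, *]

lemma IsWeightVector.act_pow {μ : Weight m n} {v : L} (h : M.IsWeightVector μ v) (i j : Idx m n)
    (r : ℕ) : M.IsWeightVector (μ + (r : ℂ) • root i j) ((M.act (E i j) ^ r) v) := by
  induction r with
  | zero => simpa using h
  | succ r ih =>
    rw [pow_succ', Module.End.mul_apply]
    convert ih.act i j using 1
    push_cast
    module

lemma IsWeightVector.unique {μ ν : Weight m n} {v : L} (hv : v ≠ 0) (h : M.IsWeightVector μ v)
    (h' : M.IsWeightVector ν v) : μ = ν := by
  funext i
  exact smul_left_injective ℂ hv ((h i).symm.trans (h' i))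

lemma IsWeightVector.act_sum {μ : Weight m n} {v : L} (h : M.IsWeightVector μ v)
    (c : Idx m n → ℂ) : M.act (∑ i, c i • E i i) v = (∑ i, c i * μ i) • v := by
  simp only [map_sum, map_smul, LinearMap.sum_apply, LinearMap.smul_apply, h _, smul_smul,
    Finset.sum_smul]

/-! ### Vectors killed by the positive root spaces of an ordering of the indices -/

variable (M)

/-- `v` is killed by `E i j` whenever `i` precedes `j` in the order defined by `p`. -/
def Killed (p : Idx m n → ℕ) (v : L) : Prop := ∀ i j, p i < p j → M.act (E i j) v = 0

/-- `Lowered p v k u`: the vector `u` arises from `v` by the action of negative root vectors of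
total height `k`. -/
inductive Lowered (p : Idx m n → ℕ) (v : L) : ℕ → L → Prop
  | base : Lowered p v 0 v
  | step {k : ℕ} {u : L} (i j : Idx m n) (hij : p i < p j) (hu : Lowered p v k u) :
      Lowered p v (k + (p j - p i)) (M.act (E j i) u)

/-- The span of all vectors obtained from `v` by the action of negative root vectors. -/
def lowerSpan (p : Idx m n → ℕ) (v : L) : Submodule ℂ L :=
  Submodule.span ℂ {u | ∃ k, M.Lowered p v k u}

variable {M}

lemma act_mem_lowerSpan_of_lt {p : Idx m n → ℕ} {v u : L} {i j : Idx m n} (hij : p i < p j)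
    (hu : u ∈ M.lowerSpan p v) : M.act (E j i) u ∈ M.lowerSpan p v := by
  induction hu using Submodule.span_induction with
  | mem x hx =>
    obtain ⟨k, hk⟩ := hx
    exact Submodule.subset_span ⟨_, hk.step i j hij⟩
  | zero => simp
  | add x y _ _ hx hy => rw [map_add]; exact add_mem hx hy
  | smul c x _ hx => rw [map_smul]; exact Submodule.smul_mem _ _ hx

lemma act_mem_of_act_E_mem {N : Submodule ℂ L} {u : L} (h : ∀ i j, M.act (E i j) u ∈ N)
    (x : Gl m n) : M.act x u ∈ N := by
  rw [eq_sum_E x]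
  simp only [map_sum, map_smul, LinearMap.sum_apply, LinearMap.smul_apply]
  exact sum_mem fun i _ => sum_mem fun j _ => N.smul_mem _ (h i j)

/-- This takes the place of the PBW theorem. Moving x past the last lowering operator f gives x f u
= [x, f] u ± f x u, and induction covers both terms because the claim is made for all matrices x,
not only for positive root vectors. -/
lemma Lowered.act_mem {p : Idx m n → ℕ} (hp : p.Injective) {v : L} {μ : Weight m n}
    (hv : M.Killed p v) (hμ : M.IsWeightVector μ v) {k : ℕ} {u : L} (hu : M.Lowered p v k u)
    (x : Gl m n) : M.act x u ∈ M.lowerSpan p v := by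
  induction hu generalizing x with
  | base =>
    refine act_mem_of_act_E_mem (fun i j => ?_) x
    have hmem : v ∈ M.lowerSpan p v := Submodule.subset_span ⟨0, .base⟩
    rcases lt_trichotomy (p i) (p j) with h | h | h
    · rw [hv i j h]
      exact zero_mem _
    · obtain rfl := hp h
      rw [hμ i]
      exact Submodule.smul_mem _ _ hmem
    · exact act_mem_lowerSpan_of_lt h hmem
  | step a b hab hu ih =>
    refine act_mem_of_act_E_mem (fun i j => ?_) x
    rw [act_E_act_E]
    exact add_mem (ih _) (Submodule.smul_mem _ _ (act_mem_lowerSpan_of_lt hab (ih _)))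

lemma Lowered.exists_mem_grade {p : Idx m n → ℕ} {v : L} {s : ZMod 2} (hv : v ∈ M.grade s)
    {k : ℕ} {u : L} (hu : M.Lowered p v k u) : ∃ t, u ∈ M.grade t := by
  induction hu with
  | base => exact ⟨s, hv⟩
  | step a b hab hu ih =>
    obtain ⟨t, ht⟩ := ih
    exact ⟨_, M.act_mem _ _ _ _ (isHomog_E b a) ht⟩

/-- Lowering moves weight from an earlier index to a later one, so with the coefficients p i the
height grows by p j - p i: lower vectors have larger height. -/
lemma Lowered.exists_weight {p : Idx m n → ℕ} {v : L} {μ : Weight m n}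
    (hμ : M.IsWeightVector μ v) {k : ℕ} {u : L} (hu : M.Lowered p v k u) :
    ∃ κ, M.IsWeightVector κ u ∧ ∑ i, (p i : ℂ) * κ i = ∑ i, (p i : ℂ) * μ i + k := by
  induction hu with
  | base => exact ⟨μ, hμ, by simp⟩
  | @step k u a b hab hu ih =>
    obtain ⟨κ, hκ, hs⟩ := ih
    refine ⟨_, hκ.act b a, ?_⟩
    simp only [Pi.add_apply, mul_add, Finset.sum_add_distrib, hs, root, Pi.sub_apply, mul_sub,
      Finset.sum_sub_distrib]
    simp [Pi.single_apply]
    rw [Nat.cast_sub hab.le]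
    ring

lemma isSubmodule_lowerSpan {p : Idx m n → ℕ} (hp : p.Injective) {v : L} {μ : Weight m n}
    {s : ZMod 2} (hs : v ∈ M.grade s) (hv : M.Killed p v) (hμ : M.IsWeightVector μ v) :
    M.IsSubmodule (M.lowerSpan p v) := by
  constructor
  · refine Submodule.span_le.mpr ?_
    rintro u ⟨k, hu⟩
    obtain ⟨t, ht⟩ := hu.exists_mem_grade hs
    exact Submodule.mem_iSup_of_mem t ⟨Submodule.subset_span ⟨k, hu⟩, ht⟩
  · intro x u hu
    induction hu using Submodule.span_induction with
    | mem u hu =>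
      obtain ⟨k, hk⟩ := hu
      exact hk.act_mem hp hv hμ x
    | zero => simp
    | add y z _ _ hy hz => rw [map_add]; exact add_mem hy hz
    | smul c y _ hy => rw [map_smul]; exact Submodule.smul_mem _ _ hy

/-- The element of the Cartan subalgebra that measures heights. -/
def heightElement (p : Idx m n → ℕ) : Gl m n := ∑ i, (p i : ℂ) • E i i

lemma Lowered.mem_eigenspace {p : Idx m n → ℕ} {v : L} {μ : Weight m n}
    (hμ : M.IsWeightVector μ v) {k : ℕ} {u : L} (hu : M.Lowered p v k u) :
    u ∈ (M.act (heightElement p)).eigenspace (∑ i, (p i : ℂ) * μ i + k) := by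
  obtain ⟨κ, hκ, hs⟩ := hu.exists_weight hμ
  rw [Module.End.mem_eigenspace_iff, heightElement, hκ.act_sum, hs]

lemma Lowered.eq_or_pos {p : Idx m n → ℕ} {v : L} {k : ℕ} {u : L} (hu : M.Lowered p v k u) :
    u = v ∨ 0 < k := by
  cases hu with
  | base => exact Or.inl rfl
  | step i j hij _ => right; omega

/-- In a simple module the span of the lowered vectors is everything. -/
lemma IsSimple.lowerSpan_eq_top (hM : M.IsSimple) {p : Idx m n → ℕ} (hp : p.Injective) {v : L}
    {μ : Weight m n} (h0 : v ≠ 0) {s : ZMod 2} (hs : v ∈ M.grade s) (hv : M.Killed p v)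
    (hμ : M.IsWeightVector μ v) : M.lowerSpan p v = ⊤ := by
  refine (hM.2 _ (isSubmodule_lowerSpan hp hs hv hμ)).resolve_left fun h => h0 ?_
  have : v ∈ M.lowerSpan p v := Submodule.subset_span ⟨0, .base⟩
  rwa [h, Submodule.mem_bot] at this

/-- The height of any weight vector exceeds that of the highest weight by a natural number. -/
lemma IsSimple.exists_height (hM : M.IsSimple) {p : Idx m n → ℕ} (hp : p.Injective) {v w : L}
    {μ ν : Weight m n} (h0 : v ≠ 0) {s : ZMod 2} (hs : v ∈ M.grade s) (hv : M.Killed p v)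
    (hμ : M.IsWeightVector μ v) (hw : w ≠ 0) (hν : M.IsWeightVector ν w) :
    ∃ k : ℕ, ∑ i, (p i : ℂ) * ν i = ∑ i, (p i : ℂ) * μ i + k := by
  by_contra! hne
  -- If no lowered vector had the height of w, the whole module would lie in the other eigenspaces,
  -- which are independent of the one containing w.
  have hle : M.lowerSpan p v ≤ ⨆ c, ⨆ _ : c ≠ ∑ i, (p i : ℂ) * ν i,
      (M.act (heightElement p)).eigenspace c := by
    refine Submodule.span_le.mpr ?_
    rintro u ⟨k, hu⟩
    exact Submodule.mem_iSup_of_mem _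
      (Submodule.mem_iSup_of_mem (hne k).symm (hu.mem_eigenspace hμ))
  rw [hM.lowerSpan_eq_top hp h0 hs hv hμ, top_le_iff] at hle
  have hd := (Module.End.eigenspaces_iSupIndep (M.act (heightElement p)))
    (∑ i, (p i : ℂ) * ν i)
  rw [hle, disjoint_top, Submodule.eq_bot_iff] at hd
  exact hw (hd w (Module.End.mem_eigenspace_iff.mpr (hν.act_sum _)))

/-- Homogeneous highest weight vectors of a simple module are unique up to scalars. -/
lemma IsSimple.mem_span_of_killed (hM : M.IsSimple) {p : Idx m n → ℕ} (hp : p.Injective)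
    {v w : L} {μ ν : Weight m n} (h0 : v ≠ 0) {s t : ZMod 2} (hs : v ∈ M.grade s)
    (hv : M.Killed p v) (hμ : M.IsWeightVector μ v) (hw0 : w ≠ 0) (ht : w ∈ M.grade t)
    (hw : M.Killed p w) (hν : M.IsWeightVector ν w) : w ∈ Submodule.span ℂ {v} := by
  obtain ⟨k, hk⟩ := hM.exists_height hp h0 hs hv hμ hw0 hν
  obtain ⟨l, hl⟩ := hM.exists_height hp hw0 ht hw hν h0 hμ
  -- Each height exceeds the other by a natural number, so they agree.
  have hkl : k + l = 0 := by
    rw [hk, add_assoc, left_eq_add] at hl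
    exact_mod_cast hl
  obtain rfl : k = 0 := by omega
  rw [Nat.cast_zero, add_zero] at hk
  -- Apart from v, every lowered vector has strictly larger height, so the part of w outside the
  -- line of v lies in the other eigenspaces and must vanish.
  have hle : M.lowerSpan p v ≤ Submodule.span ℂ {v} ⊔ ⨆ c, ⨆ _ : c ≠ ∑ i, (p i : ℂ) * μ i,
      (M.act (heightElement p)).eigenspace c := by
    refine Submodule.span_le.mpr ?_
    rintro u ⟨k, hu⟩
    rcases hu.eq_or_pos with rfl | hpos
    · exact Submodule.mem_sup_left (Submodule.mem_span_singleton_self _)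
    · refine Submodule.mem_sup_right (Submodule.mem_iSup_of_mem _
        (Submodule.mem_iSup_of_mem ?_ (hu.mem_eigenspace hμ)))
      rw [Ne, add_eq_left]
      exact_mod_cast hpos.ne'
  rw [hM.lowerSpan_eq_top hp h0 hs hv hμ, top_le_iff] at hle
  obtain ⟨y, hy, z, hz, hyz⟩ := Submodule.mem_sup.mp (hle ▸ Submodule.mem_top : w ∈ _)
  have hw' : w ∈ (M.act (heightElement p)).eigenspace (∑ i, (p i : ℂ) * μ i) :=
    Module.End.mem_eigenspace_iff.mpr (hk ▸ hν.act_sum _)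
  have hv' : Submodule.span ℂ {v} ≤
      (M.act (heightElement p)).eigenspace (∑ i, (p i : ℂ) * μ i) :=
    (Submodule.span_singleton_le_iff_mem _ _).mpr
      (Module.End.mem_eigenspace_iff.mpr (hμ.act_sum _))
  have hz' : z ∈ (M.act (heightElement p)).eigenspace (∑ i, (p i : ℂ) * μ i) := by
    rw [← eq_sub_iff_add_eq'] at hyz
    exact hyz ▸ sub_mem hw' (hv' hy)
  have hz0 := Submodule.disjoint_def.mp (Module.End.eigenspaces_iSupIndep
    (M.act (heightElement p)) (∑ i, (p i : ℂ) * μ i)) z hz' hz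
  rw [hz0, add_zero] at hyz
  exact hyz ▸ hy

/-- A nonzero vector has a nonzero homogeneous component, which is killed by the same matrix units
and has the same weight. -/
lemma exists_homogeneous {p : Idx m n → ℕ} {v : L} {μ : Weight m n} (h0 : v ≠ 0)
    (hv : M.Killed p v) (hμ : M.IsWeightVector μ v) :
    ∃ s, ∃ u ∈ M.grade s, u ≠ 0 ∧ M.Killed p u ∧ M.IsWeightVector μ u := by
  classical
  let := M.isInternal.chooseDecomposition
  -- A homogeneous operator permutes the homogeneous components, so an equation for v passes to each
  -- component.
  have hcomp : ∀ (i j : Idx m n) (s : ZMod 2), (DirectSum.decompose M.grade (M.act (E i j) v)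
      (parity i + parity j + s) : L) = M.act (E i j) (DirectSum.decompose M.grade v s) := by
    intro i j s
    conv_lhs => rw [← DirectSum.sum_support_decompose M.grade v]
    rw [map_sum, DirectSum.decompose_sum]
    rw [DFinsupp.finsetSum_apply, AddSubmonoidClass.coe_finsetSum]
    rw [Finset.sum_eq_single s]
    · exact DirectSum.decompose_of_mem_same _
        (M.act_mem _ _ _ _ (isHomog_E i j) (SetLike.coe_mem _))
    · intro t _ hts
      refine DirectSum.decompose_of_mem_ne _
        (M.act_mem _ _ _ _ (isHomog_E i j) (SetLike.coe_mem _)) fun h => hts (add_left_cancel h)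
    · intro hs
      rw [DFinsupp.notMem_support_iff.mp hs]
      simp
  obtain ⟨s, hs⟩ : ∃ s, (DirectSum.decompose M.grade v s : L) ≠ 0 := by
    by_contra! h
    apply h0
    rw [← DirectSum.sum_support_decompose M.grade v]
    exact Finset.sum_eq_zero fun i _ => h i
  refine ⟨s, _, SetLike.coe_mem _, hs, fun i j hij => ?_, fun i => ?_⟩
  · rw [← hcomp, hv i j hij]
    simp
  · have h := hcomp i i s
    rw [parity_add_self, zero_add] at h
    rw [← h, hμ i, DirectSum.decompose_smul]
    rfl

/-- The highest weight of a simple module with respect to an ordering is unique. -/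
lemma IsSimple.weight_unique (hM : M.IsSimple) {p : Idx m n → ℕ} (hp : p.Injective) {v w : L}
    {μ ν : Weight m n} (h0 : v ≠ 0) (hv : M.Killed p v) (hμ : M.IsWeightVector μ v) (hw0 : w ≠ 0)
    (hw : M.Killed p w) (hν : M.IsWeightVector ν w) : μ = ν := by
  obtain ⟨s, v', hs, h0', hv', hμ'⟩ := exists_homogeneous h0 hv hμ
  obtain ⟨t, w', ht, hw0', hw', hν'⟩ := exists_homogeneous hw0 hw hν
  obtain ⟨c, rfl⟩ := Submodule.mem_span_singleton.mp
    (hM.mem_span_of_killed hp h0' hs hv' hμ' hw0' ht hw' hν')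
  exact (hμ'.smul c).unique hw0' hν'

end SuperModule
/-! ### Row and column removal -/

lemma nat_eq_of_lt_iff {a b : ℕ} (h : ∀ k, k < a ↔ k < b) : a = b :=
  le_antisymm (not_lt.mp fun hlt => lt_irrefl b ((h b).mp hlt))
    (not_lt.mp fun hlt => lt_irrefl a ((h a).mpr hlt))

lemma rowLen_removeRow (μ : YoungDiagram) (i : ℕ) : (removeRow μ).rowLen i = μ.rowLen (i + 1) :=
  nat_eq_of_lt_iff fun k => by
    rw [← YoungDiagram.mem_iff_lt_rowLen, ← YoungDiagram.mem_iff_lt_rowLen, mem_removeRow]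

lemma colLen_removeCol (μ : YoungDiagram) (j : ℕ) : (removeCol μ).colLen j = μ.colLen (j + 1) :=
  nat_eq_of_lt_iff fun k => by
    rw [← YoungDiagram.mem_iff_lt_colLen, ← YoungDiagram.mem_iff_lt_colLen, mem_removeCol]

lemma colLen_removeRow (μ : YoungDiagram) (j : ℕ) : (removeRow μ).colLen j = μ.colLen j - 1 :=
  nat_eq_of_lt_iff fun k => by
    rw [← YoungDiagram.mem_iff_lt_colLen, mem_removeRow, YoungDiagram.mem_iff_lt_colLen]
    omega

lemma rowLen_removeCol (μ : YoungDiagram) (i : ℕ) : (removeCol μ).rowLen i = μ.rowLen i - 1 :=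
  nat_eq_of_lt_iff fun k => by
    rw [← YoungDiagram.mem_iff_lt_rowLen, mem_removeCol, YoungDiagram.mem_iff_lt_rowLen]
    omega

lemma removeRow_removeCol (μ : YoungDiagram) :
    removeRow (removeCol μ) = removeCol (removeRow μ) := by
  ext ⟨i, j⟩
  simp only [YoungDiagram.mem_cells, mem_removeRow, mem_removeCol]

lemma rowLen_zero_pos_iff (μ : YoungDiagram) : 0 < μ.rowLen 0 ↔ 0 < μ.colLen 0 := by
  rw [← YoungDiagram.mem_iff_lt_rowLen, ← YoungDiagram.mem_iff_lt_colLen]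

/-! ### Weights read off along a list -/

/-- The length that is read off for an index. -/
noncomputable def readLen : Idx m n → YoungDiagram → ℕ
  | Sum.inl _, μ => μ.rowLen 0
  | Sum.inr _, μ => μ.colLen 0

/-- The diagram that remains after an index has been read. -/
noncomputable def readRest : Idx m n → YoungDiagram → YoungDiagram
  | Sum.inl _, μ => removeRow μ
  | Sum.inr _, μ => removeCol μ

lemma readWeight_cons (x : Idx m n) (l : List (Idx m n)) (μ : YoungDiagram) :
    readWeight (x :: l) μ =
      Function.update (readWeight l (readRest x μ)) x (readLen x μ : ℂ) := by
  cases x <;> rfl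

lemma readRest_comm (x y : Idx m n) (μ : YoungDiagram) :
    readRest x (readRest y μ) = readRest y (readRest x μ) := by
  cases x <;> cases y <;> simp [readRest, removeRow_removeCol]

/-- How a highest weight changes under the reflection in the simple root `root a b`. -/
def ReflectsTo (a b : Idx m n) (μ ν : Weight m n) : Prop :=
  (parity a = parity b ∧ ∃ k : ℕ, μ a = μ b + k ∧ ν = μ + (k : ℂ) • root b a) ∨
  (parity a ≠ parity b ∧
    ((μ a + μ b = 0 ∧ ν = μ) ∨ (μ a + μ b ≠ 0 ∧ ν = μ + root b a)))

/-- The rule involves only the coordinates at `a` and `b`, and the root vanishes at `x`; this lets a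
common prefix be read first. -/
lemma ReflectsTo.update {a b x : Idx m n} {μ ν : Weight m n} (h : ReflectsTo a b μ ν)
    (ha : x ≠ a) (hb : x ≠ b) (c : ℂ) :
    ReflectsTo a b (Function.update μ x c) (Function.update ν x c) := by
  have hr : root b a x = 0 := by simp [root, ha, hb]
  have key : ∀ d : ℂ, Function.update (μ + d • root b a) x c =
      Function.update μ x c + d • root b a := by
    intro d
    funext y
    rcases eq_or_ne y x with rfl | hy <;> simp [*]
  have key1 := key 1
  rw [one_smul] at key1
  simp only [ReflectsTo, Function.update_of_ne ha.symm, Function.update_of_ne hb.symm]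
  rcases h with ⟨hp, k, hk, rfl⟩ | ⟨hp, ⟨hk, rfl⟩ | ⟨hk, rfl⟩⟩
  · exact Or.inl ⟨hp, k, hk, key k⟩
  · exact Or.inr ⟨hp, Or.inl ⟨hk, rfl⟩⟩
  · exact Or.inr ⟨hp, Or.inr ⟨hk, key1⟩⟩

lemma reflectsTo_update_update {a b : Idx m n} (hab : a ≠ b) (ρ : Weight m n)
    (μ : YoungDiagram) :
    ReflectsTo a b
      (Function.update (Function.update ρ b (readLen b (readRest a μ) : ℂ)) a (readLen a μ : ℂ))
      (Function.update (Function.update ρ a (readLen a (readRest b μ) : ℂ)) b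
        (readLen b μ : ℂ)) := by
  -- Reversing the order moves an amount d from `a` to `b`: the difference of the two lengths for
  -- equal parities, and 1 or 0 (the corner box, if there is one) for different parities.
  have key : ∀ (x y x' y' d : ℂ), x' = x - d → y' = y + d →
      Function.update (Function.update ρ a x') b y' =
        Function.update (Function.update ρ b y) a x + d • root b a := by
    rintro x y _ _ d rfl rfl
    funext z
    rcases eq_or_ne z a with rfl | hza
    · simp [root, hab, sub_eq_add_neg]
    · rcases eq_or_ne z b with rfl | hzb
      · simp [root, hza]
      · simp [root, hza, hzb]
  have hpos := rowLen_zero_pos_iff μ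
  simp only [ReflectsTo, Function.update_self, Function.update_of_ne hab.symm]
  by_cases hp : parity a = parity b
  · refine Or.inl ⟨hp, ?_⟩
    have hle : readLen b (readRest a μ) ≤ readLen a μ ∧ readLen b μ = readLen a μ ∧
        readLen a (readRest b μ) = readLen b (readRest a μ) := by
      rcases a with a | a <;> rcases b with b | b <;> simp [parity] at hp <;>
        simp only [readLen, readRest, rowLen_removeRow, colLen_removeCol, and_self, and_true]
      · exact μ.rowLen_anti _ _ (by omega)
      · exact μ.colLen_anti _ _ (by omega)
    obtain ⟨h1, h2, h3⟩ := hle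
    obtain ⟨k, hk⟩ := Nat.exists_eq_add_of_le h1
    refine ⟨k, by rw [hk]; push_cast; ring, key _ _ _ _ _ ?_ ?_⟩
    · rw [h3, hk]; push_cast; ring
    · rw [h2, hk]; push_cast; ring
  · refine Or.inr ⟨hp, ?_⟩
    have hlen : readLen b (readRest a μ) = readLen b μ - 1 ∧
        readLen a (readRest b μ) = readLen a μ - 1 ∧ (0 < readLen a μ ↔ 0 < readLen b μ) := by
      rcases a with a | a <;> rcases b with b | b <;> simp [parity] at hp <;>
        simp only [readLen, readRest, rowLen_removeCol, colLen_removeRow, true_and]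
      · exact hpos
      · exact hpos.symm
    obtain ⟨h1, h2, h3⟩ := hlen
    rw [h1, h2]
    rcases Nat.eq_zero_or_pos (readLen a μ) with h0 | h0
    -- The diagram is empty, and the truncated subtractions leave both lengths 0 in either order.
    · have h0' : readLen b μ = 0 := by omega
      refine Or.inl ⟨by simp [h0, h0'], ?_⟩
      rw [h0, h0']
      simpa using key 0 0 0 0 0 (by simp) (by simp)
    · have h0' := h3.mp h0
      refine Or.inr ⟨?_, ?_⟩
      · norm_cast
        omega
      · rw [← one_smul ℂ (root b a)]
        refine key _ _ _ _ _ ?_ ?_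
        · rw [Nat.cast_sub h0]; simp
        · rw [Nat.cast_sub h0']; simp

lemma reflectsTo_readWeight {a b : Idx m n} (hab : a ≠ b) (suf : List (Idx m n)) :
    ∀ (pre : List (Idx m n)) (μ : YoungDiagram), a ∉ pre → b ∉ pre →
      ReflectsTo a b (readWeight (pre ++ a :: b :: suf) μ) (readWeight (pre ++ b :: a :: suf) μ)
  | [], μ, _, _ => by
    simp only [List.nil_append, readWeight_cons]
    rw [readRest_comm a b]
    exact reflectsTo_update_update hab _ μ
  | x :: pre, μ, ha, hb => by
    rw [List.mem_cons, not_or] at ha hb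
    simp only [List.cons_append, readWeight_cons]
    exact (reflectsTo_readWeight hab suf pre _ ha.2 hb.2).update (Ne.symm ha.1) (Ne.symm hb.1) _

/-! ### The standard ordering -/

/-- The offset `c` makes the induction possible: after one column is removed, the remaining
consecutive indices start at `c + 1`. -/
lemma readWeight_map_inr (ks : List (Fin n)) (hks : ks.Nodup) (c : ℕ)
    (h : ∀ (t : ℕ) (ht : t < ks.length), (ks[t] : ℕ) = c + t) (μ : YoungDiagram) (x : Idx m n) :
    readWeight (ks.map Sum.inr) μ x = match x with
      | Sum.inl _ => 0
      | Sum.inr j => if j ∈ ks then (μ.colLen (j - c) : ℂ) else 0 := by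
  induction ks generalizing c μ with
  | nil => cases x <;> simp [readWeight]
  | cons k ks ih =>
    rw [List.nodup_cons] at hks
    have hk : (k : ℕ) = c := h 0 (by simp)
    have ih' := ih hks.2 (c + 1) (fun t ht => by
      have := h (t + 1) (by simpa using ht)
      rw [List.getElem_cons_succ] at this
      omega) (removeCol μ)
    rw [List.map_cons, readWeight]
    cases x with
    | inl i => simp [ih']
    | inr j =>
      rcases eq_or_ne j k with rfl | hj
      · simp [hk]
      · rw [Function.update_of_ne (by simpa using hj), ih']
        simp only [List.mem_cons, hj, false_or]
        split_ifs with hmem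
        · obtain ⟨t, ht, rfl⟩ := List.getElem_of_mem hmem
          have := h (t + 1) (by simpa using ht)
          rw [List.getElem_cons_succ] at this
          rw [colLen_removeCol, this]
          congr 2
          omega
        · rfl

lemma readWeight_map_inl_append (ks : List (Fin m)) (hks : ks.Nodup) (c : ℕ)
    (h : ∀ (t : ℕ) (ht : t < ks.length), (ks[t] : ℕ) = c + t) (l : List (Fin n))
    (μ : YoungDiagram) (x : Idx m n) :
    readWeight (ks.map Sum.inl ++ l.map Sum.inr) μ x = match x with
      | Sum.inl i => if i ∈ ks then (μ.rowLen (i - c) : ℂ) else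
          readWeight (l.map Sum.inr) (removeRow^[ks.length] μ) (Sum.inl i : Idx m n)
      | Sum.inr j =>
          readWeight (l.map Sum.inr) (removeRow^[ks.length] μ) (Sum.inr j : Idx m n) := by
  induction ks generalizing c μ with
  | nil => cases x <;> simp
  | cons k ks ih =>
    rw [List.nodup_cons] at hks
    have hk : (k : ℕ) = c := h 0 (by simp)
    have ih' := ih hks.2 (c + 1) (fun t ht => by
      have := h (t + 1) (by simpa using ht)
      rw [List.getElem_cons_succ] at this
      omega) (removeRow μ)
    rw [List.map_cons, List.cons_append, readWeight]
    cases x with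
    | inr j => simp [ih']
    | inl j =>
      rcases eq_or_ne j k with rfl | hj
      · simp [hk]
      · rw [Function.update_of_ne (by simpa using hj), ih']
        simp only [List.mem_cons, hj, false_or]
        split_ifs with hmem
        · obtain ⟨t, ht, rfl⟩ := List.getElem_of_mem hmem
          have := h (t + 1) (by simpa using ht)
          rw [List.getElem_cons_succ] at this
          rw [rowLen_removeRow, this]
          congr 2
          omega
        · rfl

/-- The indices in the standard order. -/
def standardSeq (m n : ℕ) : List (Idx m n) :=
  (List.finRange m).map Sum.inl ++ (List.finRange n).map Sum.inr

lemma readWeight_standardSeq (μ : YoungDiagram) :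
    readWeight (standardSeq m n) μ = natural m n μ := by
  funext x
  rw [standardSeq, readWeight_map_inl_append _ (List.nodup_finRange m) 0 (by simp)]
  cases x with
  | inl i => simp [natural]
  | inr j =>
    simp only [natural, List.length_finRange]
    rw [readWeight_map_inr _ (List.nodup_finRange n) 0 (by simp)]
    simp

/-! ### Alternating sequences -/

/-- Both cases are proved together, since deleting the head passes from one to the other. For a row,
p of the diagram at k + 1 equals q at k of the transposed remainder, and q at k equals p at k of the
transposed remainder. -/
lemma readWeight_alternating : ∀ (l : List (Idx m n)), l.Nodup →
    l.IsChain (fun i j => parity i ≠ parity j) → ∀ μ : YoungDiagram,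
      ((∀ x ∈ l.head?, parity x = 0) →
        (∀ k i, (l.filterMap Sum.getLeft?)[k]? = some i →
          readWeight l μ (Sum.inl i) = (frobP μ k : ℂ)) ∧
        (∀ k j, (l.filterMap Sum.getRight?)[k]? = some j →
          readWeight l μ (Sum.inr j) = (frobQ μ k : ℂ))) ∧
      ((∀ x ∈ l.head?, parity x = 1) →
        (∀ k j, (l.filterMap Sum.getRight?)[k]? = some j →
          readWeight l μ (Sum.inr j) = (frobP μ.transpose k : ℂ)) ∧
        (∀ k i, (l.filterMap Sum.getLeft?)[k]? = some i →
          readWeight l μ (Sum.inl i) = (frobQ μ.transpose k : ℂ)))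
  | [], _, _, μ => by simp
  | x :: l, hnd, hch, μ => by
    rw [List.nodup_cons] at hnd
    rw [List.isChain_cons] at hch
    have hP : ∀ ν : YoungDiagram, frobP ν 0 = ν.rowLen 0 := by intro ν; simp [frobP]
    have hne : ∀ y ∈ l, y ≠ x := by
      rintro y hy rfl
      exact hnd.1 hy
    have hl : ∀ (k : ℕ) (i : Fin m), (l.filterMap Sum.getLeft?)[k]? = some i → Sum.inl i ∈ l := by
      intro k i h
      have := List.mem_of_getElem? h
      simpa [List.mem_filterMap] using this
    have hr : ∀ (k : ℕ) (i : Fin n), (l.filterMap Sum.getRight?)[k]? = some i →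
        Sum.inr i ∈ l := by
      intro k i h
      have := List.mem_of_getElem? h
      simpa [List.mem_filterMap] using this
    rcases x with x | x
    · obtain ⟨-, ih⟩ := readWeight_alternating l hnd.2 hch.2 (removeRow μ)
      obtain ⟨ih1, ih2⟩ := ih fun y hy => by
        have := hch.1 y hy
        rcases y with y | y <;> simp_all [parity]
      refine ⟨fun _ => ⟨?_, ?_⟩, fun h => by simp [parity] at h⟩
      · rintro (_ | k) i hi
        · obtain rfl : x = i := by simpa using hi
          simp [readWeight, hP]
        · have hi' : (l.filterMap Sum.getLeft?)[k]? = some i := by simpa using hi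
          rw [readWeight, Function.update_of_ne (hne _ (hl k i hi')), ih2 k i hi']
          simp only [frobP, frobQ, YoungDiagram.colLen_transpose, rowLen_removeRow]
          push_cast
          ring_nf
      · intro k j hj
        have hj' : (l.filterMap Sum.getRight?)[k]? = some j := hj
        rw [readWeight, Function.update_of_ne (hne _ (hr k j hj')), ih1 k j hj']
        congr 1
        -- The truncation in `colLen k - 1` is harmless: for an empty column both maxima are 0.
        simp only [frobP, frobQ, YoungDiagram.rowLen_transpose, colLen_removeRow]
        omega
    · obtain ⟨ih, -⟩ := readWeight_alternating l hnd.2 hch.2 (removeCol μ)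
      obtain ⟨ih1, ih2⟩ := ih fun y hy => by
        have := hch.1 y hy
        rcases y with y | y <;> simp_all [parity]
      refine ⟨fun h => by simp [parity] at h, fun _ => ⟨?_, ?_⟩⟩
      · rintro (_ | k) i hi
        · obtain rfl : x = i := by simpa using hi
          simp [readWeight, hP]
        · have hi' : (l.filterMap Sum.getRight?)[k]? = some i := by simpa using hi
          rw [readWeight, Function.update_of_ne (hne _ (hr k i hi')), ih2 k i hi']
          simp only [frobP, frobQ, YoungDiagram.rowLen_transpose, colLen_removeCol]
          push_cast
          ring_nf
      · intro k j hj
        have hj' : (l.filterMap Sum.getLeft?)[k]? = some j := hj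
        rw [readWeight, Function.update_of_ne (hne _ (hl k j hj')), ih1 k j hj']
        congr 1
        simp only [frobP, frobQ, YoungDiagram.colLen_transpose, rowLen_removeCol]
        omega

/-! ### Boolean equality of indices, for positions via `List.idxOf` -/

instance : ReflBEq (Idx m n) where
  rfl {a} := by
    cases a with
    | inl a => exact beq_self_eq_true a
    | inr a => exact beq_self_eq_true a

instance : LawfulBEq (Idx m n) where
  eq_of_beq {a b} h := by
    cases a <;> cases b
    · exact congrArg Sum.inl (eq_of_beq h)
    · cases h
    · cases h
    · exact congrArg Sum.inr (eq_of_beq h)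

/-! ### Reflections -/

namespace SuperModule

variable {L : Type*} [AddCommGroup L] [Module ℂ L] {M : SuperModule m n L}

/-- If `a` immediately precedes `b`, then the vectors killed by all positive `E i j` other than
`E a b` are preserved by the action of `E b a`. -/
lemma act_E_eq_zero_of_adjacent {p : Idx m n → ℕ} (hp : p.Injective) {a b : Idx m n}
    (hab : p b = p a + 1) {w : L}
    (hw : ∀ i j, p i < p j → ¬ (i = a ∧ j = b) → M.act (E i j) w = 0) (r : ℕ) :
    ∀ i j, p i < p j → ¬ (i = a ∧ j = b) → M.act (E i j) ((M.act (E b a) ^ r) w) = 0 := by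
  induction r with
  | zero => simpa using hw
  | succ r ih =>
    intro i j hij hne
    rw [pow_succ', Module.End.mul_apply, act_E_act_E, ih i j hij hne, superBracket_E_E, map_sub,
      map_smul]
    -- By adjacency, an index other than `a` that precedes `b` precedes `a`. So the bracket term `E
    -- i a` is again a positive root vector different from `E a b`; likewise `E b j` below.
    have h1 : M.act (if j = b then E i a else 0) ((M.act (E b a) ^ r) w) = 0 := by
      split_ifs with h
      · subst h
        have : p i ≠ p a := fun h => hne ⟨hp h, rfl⟩
        refine ih i a (by omega) ?_
        rintro ⟨rfl, -⟩
        exact this rfl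
      · simp
    have h2 : M.act (if a = i then E b j else 0) ((M.act (E b a) ^ r) w) = 0 := by
      split_ifs with h
      · subst h
        have : p j ≠ p b := fun h => hne ⟨rfl, hp h⟩
        refine ih b j (by omega) ?_
        rintro ⟨-, rfl⟩
        exact this rfl
      · simp
    rw [LinearMap.sub_apply, LinearMap.smul_apply, h1, h2]
    simp

lemma act_E_act_E_symm {a b : Idx m n} {μ : Weight m n} {v : L}
    (hμ : M.IsWeightVector μ v) :
    M.act (E a b) (M.act (E b a) v) =
      (μ a - sign (parity a + parity b) (parity a + parity b) * μ b) • v +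
        sign (parity a + parity b) (parity a + parity b) •
          M.act (E b a) (M.act (E a b) v) := by
  rw [act_E_act_E, superBracket_E_E, add_comm (parity b) (parity a)]
  simp [hμ a, hμ b, sub_smul, mul_smul]

/-- The usual sl(2) computation: moving e past one more f contributes the value of `E a a - E b b`,
which drops by 2 with each f. -/
lemma act_E_pow_succ {a b : Idx m n} (hab : a ≠ b) (hpar : parity a = parity b) {μ : Weight m n}
    {v : L} (hμ : M.IsWeightVector μ v) (hv : M.act (E a b) v = 0) (r : ℕ) :
    M.act (E a b) ((M.act (E b a) ^ (r + 1)) v) =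
      ((r + 1) * (μ a - μ b - r) : ℂ) • (M.act (E b a) ^ r) v := by
  have hs : sign (parity a + parity b) (parity a + parity b) = 1 := by
    rw [hpar, parity_add_self, sign_zero_left]
  induction r with
  | zero => simp [act_E_act_E_symm hμ, hs, hv]
  | succ r ih =>
    rw [pow_succ', Module.End.mul_apply, act_E_act_E_symm (hμ.act_pow b a (r + 1)), hs, ih,
      map_smul, ← Module.End.mul_apply, ← pow_succ', one_smul, ← add_smul]
    congr 1
    simp [root, hab, hab.symm]
    ring

lemma sign_of_ne {s t : ZMod 2} (h : s ≠ t) : sign (s + t) (s + t) = -1 := by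
  revert s t
  have : ∀ s t : ZMod 2, s ≠ t → (s + t).val = 1 := by decide
  intro s t h
  simp [sign, this s t h]

/-- For odd e, 2 e² = [e, e] = 0. -/
lemma act_E_act_E_self {a b : Idx m n} (hpar : parity a ≠ parity b) (v : L) :
    M.act (E a b) (M.act (E a b) v) = 0 := by
  have hab : a ≠ b := fun h => hpar (h ▸ rfl)
  have h := M.act_E_act_E a b a b v
  rw [superBracket_E_E, sign_of_ne hpar] at h
  simp only [hab.symm, if_false, smul_zero, sub_zero, map_zero, LinearMap.zero_apply,
    zero_add, neg_smul, one_smul] at h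
  have : IsAddTorsionFree L := .of_isTorsionFree ℂ L
  exact self_eq_neg.mp h

/-- A vector of highest weight for an ordering in which `a` immediately precedes `b` yields one for
the ordering with `a` and `b` interchanged, whose weight is the reflected one. -/
lemma IsSimple.exists_reflected (hM : M.IsSimple) {p : Idx m n → ℕ} (hp : p.Injective)
    {a b : Idx m n} (hab : p b = p a + 1) {μ ν : Weight m n} (hr : ReflectsTo a b μ ν) {v : L}
    (h0 : v ≠ 0) (hv : M.Killed p v) (hμ : M.IsWeightVector μ v) :
    ∃ w, w ≠ 0 ∧ (∀ i j, p i < p j → ¬ (i = a ∧ j = b) → M.act (E i j) w = 0) ∧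
      M.act (E b a) w = 0 ∧ M.IsWeightVector ν w := by
  have hne : a ≠ b := by
    rintro rfl
    omega
  have hev : M.act (E a b) v = 0 := hv a b (by omega)
  have hkill := act_E_eq_zero_of_adjacent hp hab (w := v) fun i j hij _ => hv i j hij
  -- If e kills f^(r+1) v, then so do all positive root vectors. Were it nonzero, it would be a
  -- second highest weight vector, of weight different from μ.
  have hzero : ∀ r : ℕ, M.act (E a b) ((M.act (E b a) ^ (r + 1)) v) = 0 →
      (M.act (E b a) ^ (r + 1)) v = 0 := by
    intro r hr
    by_contra hcon
    have heq := hM.weight_unique hp h0 hv hμ hcon (fun i j hij => by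
      by_cases h : i = a ∧ j = b
      · obtain ⟨rfl, rfl⟩ := h
        exact hr
      · exact hkill _ i j hij h) (hμ.act_pow b a (r + 1))
    have := congrFun heq b
    simp [root, hne] at this
    norm_cast at this
  rcases hr with ⟨hpar, k, hk, rfl⟩ | ⟨hpar, ⟨hk, rfl⟩ | ⟨hk, rfl⟩⟩
  · refine ⟨(M.act (E b a) ^ k) v, ?_, hkill k, ?_, hμ.act_pow b a k⟩
    · have : ∀ r ≤ k, (M.act (E b a) ^ r) v ≠ 0 := by
        intro r
        induction r with
        | zero => simpa using h0
        | succ r ih =>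
          intro hrk h
          have h' := act_E_pow_succ hne hpar hμ hev r
          rw [h, map_zero, eq_comm, smul_eq_zero] at h'
          rcases h' with h' | h'
          · rw [hk, add_sub_cancel_left, mul_eq_zero, sub_eq_zero] at h'
            rcases h' with h' | h' <;> norm_cast at h'
            omega
          · exact ih (by omega) h'
      exact this k le_rfl
    · rw [← Module.End.mul_apply, ← pow_succ']
      refine hzero k ?_
      rw [act_E_pow_succ hne hpar hμ hev k, hk]
      simp
  · refine ⟨v, h0, fun i j hij _ => hv i j hij, ?_, hμ⟩
    have := hzero 0
    rw [zero_add, pow_one, act_E_act_E_symm hμ, sign_of_ne hpar, hev] at this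
    exact this (by simp [hk])
  · have hk1 := hkill 1
    rw [pow_one] at hk1
    refine ⟨M.act (E b a) v, fun h => ?_, hk1, act_E_act_E_self hpar.symm v, hμ.act b a⟩
    -- Here e f v = (μ a + μ b) v is nonzero, so f v cannot vanish.
    have h' := act_E_act_E_symm (a := a) (b := b) hμ
    rw [h, hev, sign_of_ne hpar] at h'
    rw [map_zero, map_zero, smul_zero, add_zero, neg_one_mul, sub_neg_eq_add] at h'
    exact smul_ne_zero hk h0 h'.symm

/-! ### Highest weight vectors along a list of indices -/

variable (M)

/-- `v` is a highest weight vector of weight `μ` with respect to the Borel subalgebra defined by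
the list `l` of all indices. -/
def IsListHighest (l : List (Idx m n)) (μ : Weight m n) (v : L) : Prop :=
  v ≠ 0 ∧ l.Pairwise (fun i j => M.act (E i j) v = 0) ∧ M.IsWeightVector μ v

variable {M}

lemma idxOf_injective_of_complete {l : List (Idx m n)} (hl : ∀ i, i ∈ l) :
    (fun i => l.idxOf i).Injective := fun i _ h => (List.idxOf_inj (hl i)).mp h

lemma IsListHighest.killed {l : List (Idx m n)} (hl : ∀ i, i ∈ l) {μ : Weight m n} {v : L}
    (h : M.IsListHighest l μ v) : M.Killed (fun i => l.idxOf i) v := by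
  intro i j hij
  have hi := List.idxOf_lt_length_iff.mpr (hl i)
  have hj := List.idxOf_lt_length_iff.mpr (hl j)
  have := List.pairwise_iff_getElem.mp h.2.1 _ _ hi hj hij
  rwa [List.getElem_idxOf, List.getElem_idxOf] at this

lemma IsSimple.exists_isListHighest_swap (hM : M.IsSimple) {pre suf : List (Idx m n)}
    {a b : Idx m n} (hnd : (pre ++ a :: b :: suf).Nodup) (hl : ∀ i, i ∈ pre ++ a :: b :: suf)
    {μ ν : Weight m n} (hr : ReflectsTo a b μ ν)
    (h : ∃ v, M.IsListHighest (pre ++ a :: b :: suf) μ v) :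
    ∃ v, M.IsListHighest (pre ++ b :: a :: suf) ν v := by
  obtain ⟨v, hv⟩ := h
  have hmem := hnd
  simp only [List.nodup_append, List.nodup_cons, List.mem_cons, not_or] at hmem
  obtain ⟨-, ⟨⟨hab, hasuf⟩, hbsuf, -⟩, hdisj⟩ := hmem
  have hapre : a ∉ pre := fun h => hdisj a h a (by simp) rfl
  have hbpre : b ∉ pre := fun h => hdisj b h b (by simp) rfl
  have hpab : (pre ++ a :: b :: suf).idxOf b = (pre ++ a :: b :: suf).idxOf a + 1 := by
    rw [List.idxOf_append_of_notMem hapre, List.idxOf_append_of_notMem hbpre,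
      List.idxOf_cons_self, List.idxOf_cons_ne _ hab, List.idxOf_cons_self]
  obtain ⟨w, hw0, hw, hwf, hwν⟩ := hM.exists_reflected (idxOf_injective_of_complete hl) hpab hr
    hv.1 (hv.killed hl) hv.2.2
  refine ⟨w, hw0, ?_, hwν⟩
  have hpair : (pre ++ a :: b :: suf).Pairwise
      (fun i j => ¬ (i = a ∧ j = b) → M.act (E i j) w = 0) := by
    refine List.pairwise_iff_getElem.mpr fun i j hi hj hij => hw _ _ ?_
    simpa only [hnd.idxOf_getElem] using hij
  -- The two lists order all pairs alike except `a`, `b`; the reversed pair is supplied by `hwf`.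
  simp only [List.pairwise_append, List.pairwise_cons] at hpair ⊢
  obtain ⟨hpre, ⟨ha, hb, hsuf⟩, hps⟩ := hpair
  refine ⟨hpre.imp_of_mem fun hi _ h => h fun e => hapre (e.1 ▸ hi), ⟨fun j hj => ?_,
    fun j hj => ha j (List.mem_cons_of_mem _ hj) fun e => hbsuf (e.2 ▸ hj),
    hsuf.imp_of_mem fun hi _ h => h fun e => hasuf (e.1 ▸ hi)⟩,
    fun i hi j hj => hps i hi j ?_ fun e => hapre (e.1 ▸ hi)⟩
  · rcases List.mem_cons.mp hj with rfl | hj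
    · exact hwf
    · exact hb j hj fun h => hab h.1.symm
  · simp only [List.mem_cons] at hj ⊢
    tauto

/-- Highest weights along `readWeight` propagate between any two orderings of the indices. -/
lemma IsSimple.exists_isListHighest_of_perm (hM : M.IsSimple) (lam : YoungDiagram)
    {l l' : List (Idx m n)} (hperm : l.Perm l') (pre : List (Idx m n)) (hnd : (pre ++ l).Nodup)
    (hl : ∀ i, i ∈ pre ++ l)
    (h : ∃ v, M.IsListHighest (pre ++ l) (readWeight (pre ++ l) lam) v) :
    ∃ v, M.IsListHighest (pre ++ l') (readWeight (pre ++ l') lam) v := by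
  induction hperm generalizing pre with
  | nil => exact h
  | cons x _ ih =>
    -- The common head joins the prefix; this is why `pre` is arbitrary.
    rw [List.append_cons] at hnd h ⊢
    exact ih _ hnd (fun i => by simpa using hl i) h
  | swap b a suf =>
    have hmem := hnd
    simp only [List.nodup_append, List.nodup_cons, List.mem_cons, not_or] at hmem
    obtain ⟨-, ⟨⟨hab, -⟩, -, -⟩, hdisj⟩ := hmem
    exact hM.exists_isListHighest_swap hnd hl (reflectsTo_readWeight hab suf pre lam
      (fun h => hdisj a h a (by simp) rfl) (fun h => hdisj b h b (by simp) rfl)) h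
  | trans h₁ _ ih₁ ih₂ =>
    have hp := h₁.append_left pre
    exact ih₂ pre (hp.nodup_iff.mp hnd) (fun i => hp.mem_iff.mp (hl i)) (ih₁ pre hnd hl h)

/-! ### Comparison with Borel subalgebras -/

lemma isWeightVector_iff {μ : Weight m n} {v : L} :
    M.IsWeightVector μ v ↔ ∀ h ∈ cartan m n, M.act h v = (∑ i, μ i * h i i) • v := by
  constructor
  · intro hμ x hx
    have hsum : x = ∑ i, x i i • E i i := by
      conv_lhs => rw [eq_sum_E x]
      refine Finset.sum_congr rfl fun i _ => Finset.sum_eq_single i (fun j _ hj => ?_) (by simp)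
      rw [hx i j hj.symm, zero_smul]
    conv_lhs => rw [hsum]
    rw [hμ.act_sum]
    simp only [mul_comm]
  · intro h i
    rw [h (E i i) fun a b hab => ?_]
    · simp [E, Matrix.single]
    · have : ¬ (i = a ∧ i = b) := by
        rintro ⟨rfl, rfl⟩
        exact hab rfl
      simp only [E, Matrix.single, Matrix.of_apply, if_neg this]

lemma forall_nilradical_iff {B : Borel m n} {v : L} :
    (∀ x ∈ B.nilradical, M.act x v = 0) ↔ ∀ i j, i ≠ j → B.le i j → M.act (E i j) v = 0 := by
  constructor
  · intro h i j hij hle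
    exact h _ (Submodule.subset_span ⟨i, j, hij, hle, rfl⟩)
  · intro h x hx
    induction hx using Submodule.span_induction with
    | mem x hx =>
      obtain ⟨i, j, hij, hle, rfl⟩ := hx
      exact h i j hij hle
    | zero => simp
    | add y z _ _ hy hz => simp [hy, hz]
    | smul c y _ hy => simp [hy]

lemma isHighestWeightVector_iff {B : Borel m n} {μ : Weight m n} {v : L} :
    M.IsHighestWeightVector B μ v ↔ M.IsListHighest B.indexSeq μ v := by
  rw [IsHighestWeightVector, IsListHighest, ← isWeightVector_iff, forall_nilradical_iff]
  refine and_congr_right fun _ => and_congr_left fun _ => ⟨fun h => ?_, fun h i j hij hle => ?_⟩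
  · exact List.Pairwise.imp₂ (fun i j hij hle => h i j hij hle) B.nodup_indexSeq
      B.pairwise_indexSeq
  · obtain ⟨a, ha, rfl⟩ := List.getElem_of_mem (B.mem_indexSeq i)
    obtain ⟨b, hb, rfl⟩ := List.getElem_of_mem (B.mem_indexSeq j)
    exact List.pairwise_iff_getElem.mp h a b ha hb (B.lt_of_le_getElem ha hb hij hle)

end SuperModule

/-! ### The standard Borel subalgebra and its ordering -/

lemma mem_standardSeq (i : Idx m n) : i ∈ standardSeq m n := by
  cases i <;> simp [standardSeq]

lemma nodup_standardSeq : (standardSeq m n).Nodup := by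
  refine List.Nodup.append ((List.nodup_finRange m).map Sum.inl_injective)
    ((List.nodup_finRange n).map Sum.inr_injective) ?_
  intro x hx hy
  simp only [List.mem_map] at hx hy
  obtain ⟨i, -, rfl⟩ := hx
  obtain ⟨j, -, h⟩ := hy
  cases h

lemma standard_le_iff {i j : Idx m n} :
    (Borel.standard m n).le i j ↔ (toLex i : Fin m ⊕ₗ Fin n) ≤ toLex j := by
  change (E i j).BlockTriangular (toLex : Idx m n → Fin m ⊕ₗ Fin n) ↔ _
  constructor
  · intro h
    by_contra hlt
    have := h (not_le.mp hlt)
    simp [E] at this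
  · intro h a b hlt
    have : ¬ (i = a ∧ j = b) := by
      rintro ⟨rfl, rfl⟩
      exact absurd hlt (not_lt.mpr h)
    simp only [E, Matrix.single, Matrix.of_apply, if_neg this]

/-- Both lists contain the same entries and are sorted for the same antisymmetric relation, so they
coincide. -/
lemma indexSeq_standard : (Borel.standard m n).indexSeq = standardSeq m n := by
  refine List.Perm.eq_of_pairwise (le := (Borel.standard m n).le)
    (fun a b _ _ => Std.Antisymm.antisymm a b) (Borel.pairwise_indexSeq _) ?_
    ((List.perm_ext_iff_of_nodup (Borel.nodup_indexSeq _) nodup_standardSeq).mpr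
      fun i => by simp [Borel.mem_indexSeq, mem_standardSeq])
  simp only [standardSeq, List.pairwise_append, List.pairwise_map, standard_le_iff,
    Sum.Lex.inl_le_inl_iff, Sum.Lex.inr_le_inr_iff]
  refine ⟨List.pairwise_le_finRange m, List.pairwise_le_finRange n, fun x hx y hy => ?_⟩
  simp only [List.mem_map] at hx hy
  obtain ⟨i, -, rfl⟩ := hx
  obtain ⟨j, -, rfl⟩ := hy
  exact Sum.Lex.inl_le_inr _ _

lemma Borel.AllOdd.isChain {B : Borel m n} (h : B.AllOdd) :
    B.indexSeq.IsChain (fun i j => parity i ≠ parity j) :=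
  List.isChain_iff_getElem.mpr fun k hk =>
    h _ _ ((B.mem_simpleRoots_iff _).mpr ⟨k, hk, rfl⟩)

end GLSuper

theorem mainTheorem4 (m n : ℕ) (lam : YoungDiagram) (hlam : GLSuper.IsHook m n lam)
    (B : GLSuper.Borel m n) :
    (∀ (L : Type*) [AddCommGroup L] [Module ℂ L] (M : GLSuper.SuperModule m n L),
      M.IsSimple →
      M.HasHighestWeight (GLSuper.Borel.standard m n) (GLSuper.natural m n lam) →
      ∀ μ : GLSuper.Weight m n,
        M.HasHighestWeight B μ ↔ μ = GLSuper.borelWeight B lam) ∧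
    (B.AllOdd →
      ((∃ i, B.indexSeq.head? = some (Sum.inl i)) →
        (∀ k i, B.deltaSeq[k]? = some i →
          GLSuper.borelWeight B lam (Sum.inl i) = (GLSuper.frobP lam k : ℂ)) ∧
        (∀ k j, B.epsSeq[k]? = some j →
          GLSuper.borelWeight B lam (Sum.inr j) = (GLSuper.frobQ lam k : ℂ))) ∧
      ((∃ j, B.indexSeq.head? = some (Sum.inr j)) →
        (∀ k j, B.epsSeq[k]? = some j →
          GLSuper.borelWeight B lam (Sum.inr j) = (GLSuper.frobP lam.transpose k : ℂ)) ∧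
        (∀ k i, B.deltaSeq[k]? = some i →
          GLSuper.borelWeight B lam (Sum.inl i) = (GLSuper.frobQ lam.transpose k : ℂ)))) := by
  refine ⟨fun L _ _ M hM ⟨v, hv⟩ => ?_, fun hodd => ?_⟩
  · rw [GLSuper.SuperModule.isHighestWeightVector_iff, GLSuper.indexSeq_standard,
      ← GLSuper.readWeight_standardSeq] at hv
    have hperm : (GLSuper.standardSeq m n).Perm B.indexSeq :=
      (List.perm_ext_iff_of_nodup GLSuper.nodup_standardSeq B.nodup_indexSeq).mpr
        fun i => by simp [GLSuper.mem_standardSeq, B.mem_indexSeq]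
    obtain ⟨w, hw⟩ := hM.exists_isListHighest_of_perm lam hperm [] GLSuper.nodup_standardSeq
      GLSuper.mem_standardSeq ⟨v, hv⟩
    rw [List.nil_append] at hw
    refine fun μ => ⟨fun ⟨u, hu⟩ => ?_, ?_⟩
    · rw [GLSuper.SuperModule.isHighestWeightVector_iff] at hu
      exact hM.weight_unique (GLSuper.SuperModule.idxOf_injective_of_complete B.mem_indexSeq) hu.1
        (hu.killed B.mem_indexSeq) hu.2.2 hw.1 (hw.killed B.mem_indexSeq) hw.2.2
    · rintro rfl
      exact ⟨w, GLSuper.SuperModule.isHighestWeightVector_iff.mpr hw⟩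
  · obtain ⟨h0, h1⟩ :=
      GLSuper.readWeight_alternating B.indexSeq B.nodup_indexSeq hodd.isChain lam
    refine ⟨fun ⟨i, hi⟩ => h0 ?_, fun ⟨j, hj⟩ => h1 ?_⟩
    · rw [hi]
      rintro _ ⟨⟩
      rfl
    · rw [hj]
      rintro _ ⟨⟩
      rfl
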